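/- Let $\omega$ be a Borel probability measure on $[0,1]$ (the endowment of a continuum of goods), and let $L^1_+(\omega)$ be the cone of nonnegative elements of $L^1(\omega)$ (bundles of goods). There are $n$ agents; agent $i$ has a utility function $U_i:L^1_+(\omega)\to\mathbb R$ that is concave, monotone ($f\ge g$ a.e. implies $U_i(f)\ge U_i(g)$) and norm-continuous, and a claim $\kappa_i>0$, with $\sum_i\kappa_i=1$. Assume that no agent is satiated by the whole endowment: for each $i$ there is $b\in L^1_+(\omega)$ with $U_i(b)>U_i(\mathbb 1)$, where $\mathbb 1$ is the constant function $1$. A classification $\pi$ is a finite partition of $[0,1]$ into intervals (commodities) of positive $\omega$-measure; for an integer $k\ge 1$, $\Pi_{(\le k)}$ is the set of classifications with at most $k$ elements. For $x\in\mathbb R^\pi_+$ put $b_{\pi,x}=\sum_{C\in\pi}\frac{x_C}{\omega(C)}\mathbb 1_C$ and $V_i(\pi,x)=U_i(b_{\pi,x})$. A configuration $\langle\pi,(x^i)\rangle$ consists of a classification $\pi$ and bundles $x^1,\dots,x^n\in\mathbb R^\pi_+$. It is competitive, written $(x^i)\in\mathcal W(\pi)$, if $\sum_i x^i_C\le\omega(C)$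 for every $C\in\pi$ and there is a price vector $p\in\mathbb R^\pi_+$ such that, for every $i$, $p\cdot x^i\le\kappa_i\sum_C p_C\,\omega(C)$, and $p\cdot y>\kappa_i\sum_C p_C\,\omega(C)$ for every $y\in\mathbb R^\pi_+$ with $V_i(\pi,y)>V_i(\pi,x^i)$. A configuration $\langle\pi,(x^i)\rangle$ Pareto-dominates $\langle\rho,(y^i)\rangle$ if $V_i(\pi,x^i)\ge V_i(\rho,y^i)$ for all $i$, with strict inequality for at least one $i$; a member of a set of configurations is Pareto-optimal in the set if no member of the set Pareto-dominates it. Let $\mathcal G_k=\{\langle\pi,(x^i)\rangle:\pi\in\Pi_{(\le k)},\ (x^i)\in\mathcal W(\pi)\}$ be the set of competitive configurations based on classifications in $\Pi_{(\le k)}$, that is, the graph of $\mathcal W$ over $\Pi_{(\le k)}$. Then $\mathcal G_k$ has a Pareto-optimal configuration. Moreover, $\mathcal G_k$ is nonempty, and it is compact in the topology of the product of the pseudo-metric $d_\omega$ on classifications and the $L^1(\omega)$-norm on the bundles $b_{\pi,x^i}$, $i=1,\dots,n$; here $d_\omega(\pi,\pi')=\max\{\delta_\omega(\pi,\pi'),\delta_\omega(\pi',\pi)\}$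 and $\delta_\omega(\pi,\pi')=\sup_{C\in\sigma(\pi)}\inf_{C'\in\sigma(\pi')}\omega(C\triangle C')$, where $\sigma(\pi)$ is the algebra generated by $\pi$. The sum of utilities $\sum_i V_i(\pi,x^i)$ attains a maximum on $\mathcal G_k$, and every configuration that maximizes it over $\mathcal G_k$ is Pareto-optimal in $\mathcal G_k$. -/

import Mathlib

open MeasureTheory Set
open scoped ENNReal symmDiff

noncomputable section

namespace Conflation

/-- Bundles of goods live in `L¹(ω)`; the bundles proper are its nonnegative elements. -/
abbrev L1 (ω : Measure unitInterval) : Type := Lp ℝ 1 ω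

/-- The primitives of the society with `n` agents: the space of goods is `[0,1]` with its Borel
`σ`-algebra, `ω` is the endowment measure with `ω [0,1] = 1`, `U i` is the utility function of
agent `i` (only its values on the cone `{b | 0 ≤ b}` matter), `κ i` is the claim of agent `i`. -/
structure Society (n : ℕ) where
  ω : Measure unitInterval
  isProb : IsProbabilityMeasure ω
  U : Fin n → L1 ω → ℝ
  concave : ∀ i, ConcaveOn ℝ {b : L1 ω | 0 ≤ b} (U i)
  monotone : ∀ i, MonotoneOn (U i) {b : L1 ω | 0 ≤ b}
  continuous : ∀ i, ContinuousOn (U i) {b : L1 ω | 0 ≤ b}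
  κ : Fin n → ℝ
  κ_pos : ∀ i, 0 < κ i
  κ_sum : ∑ i, κ i = 1

instance {n : ℕ} (E : Society n) : IsProbabilityMeasure E.ω := E.isProb

/-- A classification: a finite partition of `[0,1]` into intervals of positive measure. -/
structure Classification (ω : Measure unitInterval) where
  partition : Finpartition (univ : Set unitInterval)
  interval : ∀ C ∈ partition.parts, C.OrdConnected
  pos : ∀ C ∈ partition.parts, 0 < ω C

namespace Classification

variable {ω : Measure unitInterval}

/-- The commodities of a classification. -/
abbrev Commodity (π : Classification ω) : Type := {C : Set unitInterval // C ∈ π.partition.parts}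

/-- The number of commodities of a classification. -/
def card (π : Classification ω) : ℕ := π.partition.parts.card

lemma measurableSet (π : Classification ω) (C : π.Commodity) : MeasurableSet C.1 :=
  (π.interval C.1 C.2).measurableSet

/-- The (finite) algebra `σ(π)` generated by a classification, as a family of sets. -/
def algebra (π : Classification ω) : Set (Set unitInterval) :=
  {A | MeasurableSet[MeasurableSpace.generateFrom (π.partition.parts : Set (Set unitInterval))] A}

/-- `δ_ω(π, π') = sup_{C ∈ σ(π)} inf_{C' ∈ σ(π')} ω(C ∆ C')`. -/
def delta (π π' : Classification ω) : ℝ≥0∞ :=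
  ⨆ C ∈ π.algebra, ⨅ C' ∈ π'.algebra, ω (C ∆ C')

/-- The pseudo-metric `d_ω(π, π') = max {δ_ω(π, π'), δ_ω(π', π)}` on classifications. -/
instance : PseudoEMetricSpace (Classification ω) :=
  let inst : PseudoEMetricSpace (Set unitInterval) :=
    { edist := fun s t => ω (s ∆ t)
      edist_self := by simp
      edist_comm := fun s t => by simp only [symmDiff_comm]
      edist_triangle := fun s t u => measure_symmDiff_le s t u }
  have key : ∀ π π' : Classification ω, max (delta π π') (delta π' π) =
      Metric.hausdorffEDist π.algebra π'.algebra := fun π π' => by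
    rw [Metric.hausdorffEDist_def]; rfl
  { edist := fun π π' => max (delta π π') (delta π' π)
    edist_self := fun π => by rw [key]; exact Metric.hausdorffEDist_self
    edist_comm := fun π π' => max_comm _ _
    edist_triangle := fun π π' π'' => by
      simp only [key]; exact Metric.hausdorffEDist_triangle }

/-- The bundle of goods `∑_C (x_C / ω(C)) 1_C` represented by a tradable bundle `x`. -/
def toBundle [IsFiniteMeasure ω] (π : Classification ω) (x : π.Commodity → ℝ) : L1 ω :=
  ∑ C : π.Commodity, indicatorConstLp 1 (π.measurableSet C) (measure_ne_top ω C.1)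
    (x C / ω.real C.1)

end Classification

variable {n : ℕ}

/-- `V_i(π, x) = U_i(∑_C (x_C / ω(C)) 1_C)`. -/
def Society.V (E : Society n) (i : Fin n) (π : Classification E.ω) (x : π.Commodity → ℝ) : ℝ :=
  E.U i (π.toBundle x)

/-- The whole endowment of goods as a bundle: the constant function `1`. -/
def Society.wholeEndowment (E : Society n) : L1 E.ω := Lp.const 1 E.ω (1 : ℝ)

/-- The price-and-allocation pair `⟨p, (x^i)⟩` is a competitive equilibrium of the exchange economy
induced by `π`, in which agent `i` owns the fraction `κ i` of each commodity. -/
structure IsEquilibrium (E : Society n) (π : Classification E.ω)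
    (p : π.Commodity → ℝ) (x : Fin n → π.Commodity → ℝ) : Prop where
  price_nonneg : ∀ C, 0 ≤ p C
  nonneg : ∀ i C, 0 ≤ x i C
  feasible : ∀ C, ∑ i, x i C ≤ E.ω.real C.1
  budget : ∀ i, ∑ C, p C * x i C ≤ E.κ i * ∑ C, p C * E.ω.real C.1
  optimal : ∀ i, ∀ y : π.Commodity → ℝ, (∀ C, 0 ≤ y C) → E.V i π (x i) < E.V i π y →
    E.κ i * ∑ C, p C * E.ω.real C.1 < ∑ C, p C * y C

/-- The correspondence `W`: the competitive equilibrium allocations under `π`. -/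
def W (E : Society n) (π : Classification E.ω) : Set (Fin n → π.Commodity → ℝ) :=
  {x | ∃ p, IsEquilibrium E π p x}

/-- A configuration `⟨π, (x^i)⟩`: a classification and a tradable bundle for each agent. -/
structure Configuration (E : Society n) where
  π : Classification E.ω
  x : Fin n → π.Commodity → ℝ
  nonneg : ∀ i C, 0 ≤ x i C

namespace Configuration

variable {E : Society n}

/-- The utility of agent `i` in a configuration. -/
def utility (c : Configuration E) (i : Fin n) : ℝ := E.V i c.π (c.x i)

/-- The sum of the agents' utilities in a configuration. -/
def welfare (c : Configuration E) : ℝ := ∑ i, c.utility i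

/-- `c` Pareto-dominates `d`. -/
def ParetoDominates (c d : Configuration E) : Prop :=
  (∀ i, d.utility i ≤ c.utility i) ∧ ∃ i, d.utility i < c.utility i

/-- `c` is Pareto-optimal in the set `F`. -/
def IsParetoOptimal (F : Set (Configuration E)) (c : Configuration E) : Prop :=
  c ∈ F ∧ ¬ ∃ d ∈ F, d.ParetoDominates c

/-- Configurations carry the topology of the product of `d_ω` (for the classification) and of the
`L¹(ω)`-norm (for the bundles of goods that the agents receive). -/
instance : TopologicalSpace (Configuration E) :=
  TopologicalSpace.induced
    (fun c : Configuration E => (c.π, fun i => c.π.toBundle (c.x i))) inferInstance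

end Configuration

/-- The graph of `W` over `Π_(≤ k)`, i.e. the set of competitive configurations based on
classifications with at most `k` commodities. -/
def graphW (E : Society n) (k : ℕ) : Set (Configuration E) :=
  {c | c.π.card ≤ k ∧ c.x ∈ W E c.π}

end Conflation

end

/-!
Every classification with at most `k` commodities consists of the nonempty fibres of a monotone map
from the goods to `Fin k`, and `d_ω` is at most the measure of the set where two such labellings
differ. Pointwise limits of monotone labellings are monotone, and
they are limits in measure (`tendsto_measure_ne`), because on a compact subset of a fibre of the
limit all labels are right as soon as the two extreme ones are. Hence, along an ultrafilter of
competitive configurations, the labellings, the amounts of each good per label and the shares of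
the commodities in total wealth converge together, and so do the bundles of goods.

The danger is that commodities become negligible in the limit while wealth stays concentrated in
them. Nonsatiation excludes this (`IsLabelledEquilibrium.price_eq_zero_of_null`): a nonsatiated
agent prefers some constant bundle to the whole endowment, so by concavity is locally nonsatiated
at every feasible bundle and has to spend the full claim on the commodities that are not
negligible; the claims add up to the whole wealth. So the equilibrium conditions pass to the limit
(`IsLabelledEquilibrium.of_tendsto`), and negligible intervals can be merged into their neighbours
(`exists_labelling_charged`), which proves that the set of competitive configurations is compact.

The set is nonempty because with the single commodity `[0,1]` the proportional allocation is
competitive. Welfare is continuous, so it attains its maximum, and a Pareto improvement would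
raise it.
-/

namespace Conflation

open Filter Topology

/-! ### Step bundles along monotone labellings -/

section Step

variable {ω : Measure unitInterval} {k : ℕ}

lemma ordConnected_fiber (f : unitInterval →o Fin k) (l : Fin k) : (f ⁻¹' {l}).OrdConnected :=
  ordConnected_singleton.preimage_mono f.monotone

lemma measurableSet_fiber (f : unitInterval →o Fin k) (l : Fin k) : MeasurableSet (f ⁻¹' {l}) :=
  (ordConnected_fiber f l).measurableSet

/-- Collapsing the fibres of measure zero: every labelling agrees almost everywhere with one all of
whose values have a fibre of positive measure. Each label moves to the greatest charged label at or below
it, or to the least charged label if there is none. -/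
lemma exists_labelling_charged [NeZero ω] (f : unitInterval →o Fin k) :
    ∃ g : unitInterval →o Fin k, ω {t | f t ≠ g t} = 0 ∧ ∀ t, ω (g ⁻¹' {g t}) ≠ 0 := by
  classical
  set P : Finset (Fin k) := Finset.univ.filter fun l => ω (f ⁻¹' {l}) ≠ 0 with hP
  have hnull : ω {t | f t ∉ P} = 0 := by
    refine measure_mono_null (t := ⋃ l : {l // l ∉ P}, f ⁻¹' {l.1})
      (fun t ht => mem_iUnion.2 ⟨⟨f t, ht⟩, rfl⟩) (measure_iUnion_null fun l => ?_)
    simpa [hP] using l.2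
  have hne : P.Nonempty := by
    by_contra h
    rw [Finset.not_nonempty_iff_eq_empty] at h
    simp [h] at hnull
    exact NeZero.ne ω hnull
  have hne' : ∀ l, (P.filter (· ≤ max l (P.min' hne))).Nonempty := fun l =>
    ⟨P.min' hne, Finset.mem_filter.2 ⟨P.min'_mem hne, le_max_right _ _⟩⟩
  let r : Fin k →o Fin k :=
    ⟨fun l => (P.filter (· ≤ max l (P.min' hne))).max' (hne' l), fun a b hab =>
      Finset.max'_subset _ fun x hx => by
        rw [Finset.mem_filter] at hx ⊢
        exact ⟨hx.1, hx.2.trans (max_le_max_right _ hab)⟩⟩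
  have hrP : ∀ l, r l ∈ P := fun l => (Finset.mem_filter.1 (Finset.max'_mem _ (hne' l))).1
  have hr : ∀ l ∈ P, r l = l := fun l hl => by
    refine le_antisymm ?_ (Finset.le_max' _ _ (Finset.mem_filter.2 ⟨hl, le_max_left _ _⟩))
    have := (Finset.mem_filter.1 (Finset.max'_mem _ (hne' l))).2
    exact this.trans_eq (max_eq_left (P.min'_le l hl))
  refine ⟨r.comp f, measure_mono_null (t := {t | f t ∉ P}) (fun t ht hf => ht ?_) hnull,
    fun t h0 => ?_⟩
  · exact (hr _ hf).symm
  · refine (Finset.mem_filter.1 (hrP (f t))).2 (measure_mono_null (fun s hs => ?_) h0)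
    have hs' : f s = r (f t) := hs
    change r (f s) = r (f t)
    rw [hs', hr _ (hrP _)]

/-- The bundle of goods that gives `v l` units of every good with label `l`, for a monotone
labelling `f` of the goods; it is `v ∘ f` as an element of `L¹(ω)`. -/
noncomputable def step (ω : Measure unitInterval) [IsFiniteMeasure ω] (f : unitInterval →o Fin k)
    (v : Fin k → ℝ) : L1 ω :=
  ∑ l, indicatorConstLp 1 (measurableSet_fiber f l) (measure_ne_top ω _) (v l)

lemma coeFn_sum_Lp {ι : Type*} (s : Finset ι) (g : ι → L1 ω) :
    ⇑(∑ l ∈ s, g l) =ᵐ[ω] fun t => ∑ l ∈ s, g l t := by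
  classical
  induction s using Finset.induction_on with
  | empty =>
    filter_upwards [Lp.coeFn_zero ℝ 1 ω] with t h
    simpa using h
  | insert a s ha ih =>
    rw [Finset.sum_insert ha]
    filter_upwards [Lp.coeFn_add (g a) (∑ l ∈ s, g l), ih] with t h1 h2
    rw [h1, Pi.add_apply, h2, Finset.sum_insert ha]

variable [IsFiniteMeasure ω]

lemma coeFn_step (f : unitInterval →o Fin k) (v : Fin k → ℝ) :
    ⇑(step ω f v) =ᵐ[ω] fun t => v (f t) := by
  classical
  have h : ∀ᵐ t ∂ω, ∀ l : Fin k,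
      indicatorConstLp 1 (measurableSet_fiber f l) (measure_ne_top ω _) (v l) t =
        (f ⁻¹' {l}).indicator (fun _ => v l) t :=
    ae_all_iff.2 fun l => indicatorConstLp_coeFn
  filter_upwards [coeFn_sum_Lp Finset.univ fun l =>
    indicatorConstLp 1 (measurableSet_fiber f l) (measure_ne_top ω _) (v l), h] with t h1 h2
  rw [step, h1]
  simp [h2, indicator_apply]

lemma step_le_step {f : unitInterval →o Fin k} {u v : Fin k → ℝ} (h : ∀ t, u (f t) ≤ v (f t)) :
    step ω f u ≤ step ω f v := by
  rw [← Lp.coeFn_le]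
  filter_upwards [coeFn_step (ω := ω) f u, coeFn_step (ω := ω) f v] with t h1 h2
  rw [h1, h2]
  exact h t

lemma step_congr_of_null {f : unitInterval →o Fin k} {u v : Fin k → ℝ}
    (h : ∀ l, ω (f ⁻¹' {l}) ≠ 0 → u l = v l) : step ω f u = step ω f v := by
  have h0 : ∀ᵐ t ∂ω, ∀ l, ω (f ⁻¹' {l}) = 0 → t ∉ f ⁻¹' {l} :=
    ae_all_iff.2 fun l => ae_all_iff.2 fun hl => measure_eq_zero_iff_ae_notMem.1 hl
  refine Lp.ext ?_
  filter_upwards [coeFn_step (ω := ω) f u, coeFn_step (ω := ω) f v, h0] with t h1 h2 h3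
  rw [h1, h2]
  exact h _ fun h4 => h3 _ h4 rfl

lemma step_const (f : unitInterval →o Fin k) (a : ℝ) : step ω f (fun _ => a) = Lp.const 1 ω a := by
  refine Lp.ext ?_
  filter_upwards [coeFn_step (ω := ω) f fun _ => a, Lp.coeFn_const 1 ω a] with t h1 h2
  rw [h1, h2, Function.const_apply]

lemma step_nonneg {f : unitInterval →o Fin k} {v : Fin k → ℝ} (hv : ∀ l, 0 ≤ v l) :
    0 ≤ step ω f v := by
  rw [← Lp.coeFn_nonneg]
  filter_upwards [coeFn_step (ω := ω) f v] with t h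
  rw [h]
  exact hv _

lemma step_combination (f : unitInterval →o Fin k) (a b : ℝ) (u v : Fin k → ℝ) :
    step ω f (fun l => a * u l + b * v l) = a • step ω f u + b • step ω f v := by
  refine Lp.ext ?_
  filter_upwards [coeFn_step (ω := ω) f u, coeFn_step (ω := ω) f v,
    coeFn_step (ω := ω) f (fun l => a * u l + b * v l),
    Lp.coeFn_add (a • step ω f u) (b • step ω f v),
    Lp.coeFn_smul a (step ω f u), Lp.coeFn_smul b (step ω f v)] with t h1 h2 h3 h4 h5 h6
  rw [h3, h4, Pi.add_apply, h5, h6, Pi.smul_apply, Pi.smul_apply, h1, h2, smul_eq_mul,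
    smul_eq_mul]

/-- A pointwise limit of monotone labellings is also a limit in measure: inside each fibre of the
limit take a compact set of nearly full measure; as soon as the labels of its two extreme points
are right, monotonicity makes all labels on it right. -/
lemma tendsto_measure_ne [ω.InnerRegularCompactLTTop] {ι : Type*} {F : Filter ι}
    (f : ι → unitInterval →o Fin k) (g : unitInterval →o Fin k) (h : ∀ t, ∀ᶠ c in F, f c t = g t) :
    Tendsto (fun c => ω {t | f c t ≠ g t}) F (𝓝 0) := by
  rw [ENNReal.tendsto_nhds_zero]
  intro ε hε
  rcases Nat.eq_zero_or_pos k with rfl | hk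
  · exact (g 0).elim0
  have hk' : (k : ℝ≥0∞) ≠ 0 := by exact_mod_cast hk.ne'
  have hε' : ε / k ≠ 0 := ENNReal.div_ne_zero.2 ⟨hε.ne', ENNReal.natCast_ne_top k⟩
  have hK : ∀ l : Fin k, ∃ K ⊆ g ⁻¹' {l}, IsCompact K ∧ ω ((g ⁻¹' {l}) \ K) < ε / k := fun l =>
    (measurableSet_fiber g l).exists_isCompact_sdiff_lt (measure_ne_top ω _) hε'
  choose K hKg hKc hKε using hK
  have hev : ∀ l, ∀ᶠ c in F, ∀ t ∈ K l, f c t = l := by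
    intro l
    rcases (K l).eq_empty_or_nonempty with he | hne
    · simp [he]
    obtain ⟨a, ha, hal⟩ := (hKc l).exists_isLeast hne
    obtain ⟨b, hb, hbl⟩ := (hKc l).exists_isGreatest hne
    filter_upwards [h a, h b] with c hca hcb t ht
    have h1 := (f c).monotone (hal ht)
    have h2 := (f c).monotone (hbl ht)
    rw [hca, show g a = l from hKg l ha] at h1
    rw [hcb, show g b = l from hKg l hb] at h2
    exact le_antisymm h2 h1
  filter_upwards [eventually_all.2 hev] with c hc
  calc ω {t | f c t ≠ g t} ≤ ω (⋃ l, (g ⁻¹' {l}) \ K l) := by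
        refine measure_mono fun t ht => mem_iUnion.2 ⟨g t, rfl, fun htK => ht (hc _ t htK)⟩
    _ ≤ ∑ l, ω ((g ⁻¹' {l}) \ K l) := measure_iUnion_fintype_le _ _
    _ ≤ ∑ _l : Fin k, ε / k := Finset.sum_le_sum fun l _ => (hKε l).le
    _ = ε := by
        simp [ENNReal.mul_div_cancel hk' (ENNReal.natCast_ne_top k)]

lemma tendsto_step {ι : Type*} {F : Filter ι} {f : ι → unitInterval →o Fin k}
    {g : unitInterval →o Fin k} (h : Tendsto (fun c => ω {t | f c t ≠ g t}) F (𝓝 0))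
    {v : ι → Fin k → ℝ} {u : Fin k → ℝ} (hv : Tendsto v F (𝓝 u)) :
    Tendsto (fun c => step ω (f c) (v c)) F (𝓝 (step ω g u)) := by
  classical
  have hsmul : ∀ (f : unitInterval →o Fin k) (v : Fin k → ℝ), step ω f v = ∑ l, v l •
      indicatorConstLp 1 (measurableSet_fiber f l) (measure_ne_top ω _) (1 : ℝ) := by
    intro f v
    refine Finset.sum_congr rfl fun l _ => ?_
    refine Lp.ext ?_
    filter_upwards [indicatorConstLp_coeFn (p := 1) (hs := measurableSet_fiber f l)
      (hμs := measure_ne_top ω _) (c := v l), indicatorConstLp_coeFn (p := 1)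
      (hs := measurableSet_fiber f l) (hμs := measure_ne_top ω _) (c := (1 : ℝ)),
      Lp.coeFn_smul (v l) (indicatorConstLp 1 (measurableSet_fiber f l) (measure_ne_top ω _)
        (1 : ℝ))] with t h1 h2 h3
    rw [h1, h3, Pi.smul_apply, h2]
    simp [indicator_apply]
  simp only [hsmul]
  refine tendsto_finsetSum _ fun l _ => (tendsto_pi_nhds.1 hv l).smul ?_
  refine tendsto_indicatorConstLp_set ENNReal.one_ne_top ?_
  refine tendsto_of_tendsto_of_tendsto_of_le_of_le tendsto_const_nhds h (fun _ => zero_le)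
    fun c => measure_mono ?_
  rintro t (⟨h1, h2⟩ | ⟨h1, h2⟩) h3
  · exact h2 (h3.symm.trans h1)
  · exact h2 (h3.trans h1)

end Step

/-! ### Classifications as fibres of monotone labellings -/

section Labelling

variable {ω : Measure unitInterval} {k : ℕ}

/-- A monotone labelling of the goods by `Fin k` whose nonempty fibres are the commodities of `π`;
`idx C` is the label of the goods in the commodity `C`. Labels may remain unused. -/
structure Labelling (π : Classification ω) (k : ℕ) where
  f : unitInterval →o Fin k
  idx : π.Commodity → Fin k
  fiber : ∀ C, f ⁻¹' {idx C} = C.1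

namespace Classification

lemma exists_mem (π : Classification ω) (t : unitInterval) : ∃ C : π.Commodity, t ∈ C.1 := by
  have h : t ∈ π.partition.parts.sup id := π.partition.sup_parts.symm ▸ mem_univ t
  rw [Finset.sup_id_set_eq_sUnion] at h
  obtain ⟨C, hC, ht⟩ := h
  exact ⟨⟨C, hC⟩, ht⟩

lemma eq_of_mem (π : Classification ω) {C D : π.Commodity} {t : unitInterval} (hC : t ∈ C.1)
    (hD : t ∈ D.1) : C = D := by
  by_contra h
  have := π.partition.disjoint C.2 D.2 fun h' => h (Subtype.ext h')
  exact disjoint_left.1 this hC hD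

lemma nonempty (π : Classification ω) (C : π.Commodity) : C.1.Nonempty :=
  nonempty_of_measure_ne_zero (π.pos _ C.2).ne'

lemma measureReal_pos [IsFiniteMeasure ω] (π : Classification ω) (C : π.Commodity) :
    0 < ω.real C.1 :=
  ENNReal.toReal_pos (π.pos _ C.2).ne' (measure_ne_top ω _)

/-- A good is labelled by the number of commodities lying strictly below its own commodity. -/
lemma exists_labelling (π : Classification ω) (hk : π.card ≤ k) : Nonempty (Labelling π k) := by
  classical
  let B : unitInterval → Finset π.Commodity := fun t =>
    Finset.univ.filter fun C => ∃ y ∈ C.1, y ≤ t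
  have hBmono : ∀ {s t}, s ≤ t → B s ⊆ B t := fun {s t} hst C hC => by
    obtain ⟨y, hy, hys⟩ := (Finset.mem_filter.1 hC).2
    exact Finset.mem_filter.2 ⟨Finset.mem_univ _, y, hy, hys.trans hst⟩
  have hself : ∀ {t} {C : π.Commodity}, t ∈ C.1 → C ∈ B t := fun {t C} ht =>
    Finset.mem_filter.2 ⟨Finset.mem_univ _, t, ht, le_rfl⟩
  have hpos : ∀ t, 0 < (B t).card := fun t => by
    obtain ⟨C, hC⟩ := π.exists_mem t
    exact Finset.card_pos.2 ⟨C, hself hC⟩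
  have hcard : ∀ t, (B t).card ≤ k := fun t => by
    refine (Finset.card_le_univ _).trans ?_
    rw [Fintype.card_coe]
    exact hk
  have hsame : ∀ {s t} {C : π.Commodity}, s ∈ C.1 → t ∈ C.1 → s ≤ t → B t ⊆ B s := by
    intro s t C hs ht hst D hD
    obtain ⟨y, hy, hyt⟩ := (Finset.mem_filter.1 hD).2
    rcases le_total y s with h | h
    · exact Finset.mem_filter.2 ⟨Finset.mem_univ _, y, hy, h⟩
    · rw [π.eq_of_mem hy ((π.interval _ C.2).out hs ht ⟨h, hyt⟩)]
      exact hself hs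
  have hmem : ∀ {s t} {C : π.Commodity}, t ∈ C.1 → (B s).card = (B t).card → s ≤ t → s ∈ C.1 := by
    intro s t C ht hst hle
    have hC : C ∈ B s := by
      rw [Finset.eq_of_subset_of_card_le (hBmono hle) hst.ge]
      exact hself ht
    obtain ⟨y, hy, hys⟩ := (Finset.mem_filter.1 hC).2
    exact (π.interval _ C.2).out hy ht ⟨hys, hle⟩
  let f : unitInterval →o Fin k :=
    ⟨fun t => ⟨(B t).card - 1, by have := hpos t; have := hcard t; omega⟩, fun s t hst => by
      have := Finset.card_le_card (hBmono hst)
      simp only [Fin.mk_le_mk]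
      omega⟩
  have hf : ∀ {s t}, f s = f t ↔ (B s).card = (B t).card := fun {s t} => by
    have h1 := hpos s
    have h2 := hpos t
    change (⟨_, _⟩ : Fin k) = ⟨_, _⟩ ↔ _
    rw [Fin.mk.injEq]
    omega
  refine ⟨⟨f, fun C => f (π.nonempty C).some, fun C => ?_⟩⟩
  have ha := (π.nonempty C).some_mem
  set a := (π.nonempty C).some
  ext t
  rw [mem_preimage, mem_singleton_iff, hf]
  constructor
  · intro h
    rcases le_total t a with hta | hta
    · exact hmem ha h hta
    · obtain ⟨D, hD⟩ := π.exists_mem t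
      have := hmem hD h.symm hta
      rwa [π.eq_of_mem ha this]
  · intro ht
    rcases le_total t a with hta | hta
    · exact congrArg _ ((hBmono hta).antisymm (hsame ht ha hta))
    · exact congrArg _ ((hsame ha ht hta).antisymm (hBmono hta))

/-- A labelling all of whose values have a fibre of positive measure induces a classification. -/
lemma exists_of_charged (f : unitInterval →o Fin k) (hf : ∀ t, ω (f ⁻¹' {f t}) ≠ 0) :
    ∃ (π : Classification ω) (L : Labelling π k), L.f = f := by
  classical
  let parts : Finset (Set unitInterval) :=
    (Finset.univ.filter fun l => ω (f ⁻¹' {l}) ≠ 0).image fun l => f ⁻¹' {l}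
  have hparts : ∀ C ∈ parts, ∃ l, ω (f ⁻¹' {l}) ≠ 0 ∧ f ⁻¹' {l} = C := fun C hC => by
    obtain ⟨l, hl, rfl⟩ := Finset.mem_image.1 hC
    exact ⟨l, (Finset.mem_filter.1 hl).2, rfl⟩
  let P : Finpartition (univ : Set unitInterval) :=
    { parts := parts
      supIndep := by
        rw [Finset.supIndep_iff_pairwiseDisjoint]
        intro C hC D hD hCD
        obtain ⟨l, -, rfl⟩ := hparts C hC
        obtain ⟨m, -, rfl⟩ := hparts D hD
        refine disjoint_left.2 fun t (hl : f t = l) (hm : f t = m) => hCD ?_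
        rw [← hl, ← hm]
      sup_parts := by
        rw [Finset.sup_id_set_eq_sUnion, sUnion_eq_univ_iff]
        exact fun t => ⟨f ⁻¹' {f t}, Finset.mem_image.2
          ⟨f t, Finset.mem_filter.2 ⟨Finset.mem_univ _, hf t⟩, rfl⟩, rfl⟩
      bot_notMem := fun h => by
        obtain ⟨l, hl, h0⟩ := hparts _ h
        exact hl (by rw [h0]; exact measure_empty) }
  let π : Classification ω :=
    { partition := P
      interval := fun C hC => by
        obtain ⟨l, -, rfl⟩ := hparts C hC
        exact ordConnected_fiber f l
      pos := fun C hC => by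
        obtain ⟨l, hl, rfl⟩ := hparts C hC
        exact pos_iff_ne_zero.2 hl }
  exact ⟨π, ⟨f, fun C => (hparts C.1 C.2).choose, fun C => (hparts C.1 C.2).choose_spec.2⟩, rfl⟩

end Classification

namespace Labelling

variable {π π' : Classification ω}

lemma idx_injective (L : Labelling π k) : Function.Injective L.idx := fun C D h =>
  Subtype.ext (by rw [← L.fiber C, ← L.fiber D, h])

lemma card_le (L : Labelling π k) : π.card ≤ k := by
  have := Fintype.card_le_of_injective _ L.idx_injective
  rwa [Fintype.card_coe, Fintype.card_fin] at this

lemma f_eq (L : Labelling π k) {C : π.Commodity} {t : unitInterval} (ht : t ∈ C.1) :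
    L.f t = L.idx C := by
  rw [← L.fiber C] at ht
  exact ht

lemma f_mem_range (L : Labelling π k) (t : unitInterval) : L.f t ∈ range L.idx := by
  obtain ⟨C, hC⟩ := π.exists_mem t
  exact ⟨C, (L.f_eq hC).symm⟩

lemma fiber_eq_empty (L : Labelling π k) {l : Fin k} (hl : l ∉ range L.idx) :
    L.f ⁻¹' {l} = ∅ :=
  eq_empty_of_forall_notMem fun t (ht : L.f t = l) => hl (ht ▸ L.f_mem_range t)

lemma mem_algebra_iff (L : Labelling π k) {A : Set unitInterval} :
    A ∈ π.algebra ↔ ∃ S : Set (Fin k), L.f ⁻¹' S = A := by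
  constructor
  · intro hA
    have hle : MeasurableSpace.generateFrom (π.partition.parts : Set (Set unitInterval)) ≤
        MeasurableSpace.comap L.f ⊤ :=
      MeasurableSpace.generateFrom_le fun C hC => ⟨{L.idx ⟨C, hC⟩}, trivial, L.fiber ⟨C, hC⟩⟩
    obtain ⟨S, -, hS⟩ := hle A hA
    exact ⟨S, hS⟩
  · rintro ⟨S, rfl⟩
    rw [← biUnion_preimage_singleton]
    refine @MeasurableSet.biUnion _ _
      (MeasurableSpace.generateFrom (π.partition.parts : Set (Set unitInterval))) _ _
      (to_countable S) fun l _ => ?_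
    by_cases hl : l ∈ range L.idx
    · obtain ⟨C, rfl⟩ := hl
      rw [L.fiber]
      exact MeasurableSpace.measurableSet_generateFrom C.2
    · rw [L.fiber_eq_empty hl]
      exact @MeasurableSet.empty _ (MeasurableSpace.generateFrom _)

lemma delta_le (L : Labelling π k) (L' : Labelling π' k) :
    Classification.delta π π' ≤ ω {t | L.f t ≠ L'.f t} := by
  refine iSup₂_le fun A hA => ?_
  obtain ⟨S, rfl⟩ := L.mem_algebra_iff.1 hA
  refine (iInf₂_le (L'.f ⁻¹' S) (L'.mem_algebra_iff.2 ⟨S, rfl⟩)).trans (measure_mono ?_)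
  rintro t (⟨h1, h2⟩ | ⟨h1, h2⟩) h3
  · exact h2 (show L'.f t ∈ S from h3 ▸ h1)
  · exact h2 (show L.f t ∈ S from h3.symm ▸ h1)

lemma edist_le (L : Labelling π k) (L' : Labelling π' k) :
    edist π π' ≤ ω {t | L.f t ≠ L'.f t} := by
  refine max_le (L.delta_le L') ?_
  simpa only [ne_comm] using L'.delta_le L

lemma sum_idx (L : Labelling π k) {F : Fin k → ℝ} (hF : ∀ l ∉ range L.idx, F l = 0) :
    ∑ C, F (L.idx C) = ∑ l, F l :=
  Fintype.sum_of_injective L.idx L.idx_injective _ _ hF fun _ => rfl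

lemma toBundle_eq_step [IsFiniteMeasure ω] (L : Labelling π k) {x : π.Commodity → ℝ}
    {v : Fin k → ℝ} (h : ∀ C, x C / ω.real C.1 = v (L.idx C)) :
    π.toBundle x = step ω L.f v := by
  refine Fintype.sum_of_injective L.idx L.idx_injective _ _ (fun l hl => ?_) fun C => ?_
  · simp only [L.fiber_eq_empty hl]
    exact indicatorConstLp_empty
  · simp only [L.fiber, h]

end Labelling

end Labelling

/-! ### Competitive equilibrium in terms of labels -/

section Equilibrium

variable {n k : ℕ} {E : Society n}

/-- Agent `i` strictly prefers some nonnegative bundle of goods to the whole endowment. -/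
def Society.Nonsatiated (E : Society n) : Prop :=
  ∀ i, ∃ b : L1 E.ω, 0 ≤ b ∧ E.U i E.wholeEndowment < E.U i b

/-- A nonsatiated agent strictly prefers some multiple of the whole endowment to the whole
endowment, because bounded functions are dense in `L¹(ω)`. -/
lemma Society.Nonsatiated.exists_const (hns : E.Nonsatiated) (i : Fin n) :
    ∃ M : ℝ, 0 ≤ M ∧ E.U i E.wholeEndowment < E.U i (Lp.const 1 E.ω M) := by
  obtain ⟨b, hb, hlt⟩ := hns i
  have hcont : Continuous fun c : L1 E.ω => E.U i (c ⊔ 0) :=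
    (E.continuous i).comp_continuous (continuous_id.sup continuous_const) fun c =>
      (le_sup_right : (0 : L1 E.ω) ≤ c ⊔ 0)
  have hopen : IsOpen {c : L1 E.ω | E.U i E.wholeEndowment < E.U i (c ⊔ 0)} :=
    isOpen_lt continuous_const hcont
  obtain ⟨g, hg⟩ := (ContinuousMap.toLp_denseRange ℝ E.ω ℝ (p := 1)
    ENNReal.one_ne_top).exists_mem_open hopen ⟨b, by
    change E.U i E.wholeEndowment < E.U i (b ⊔ 0)
    rwa [sup_eq_left.2 hb]⟩
  have h0 : (0 : L1 E.ω) ≤ Lp.const 1 E.ω ‖g‖ := by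
    rw [← Lp.coeFn_nonneg]
    filter_upwards [Lp.coeFn_const 1 E.ω ‖g‖] with t ht
    rw [ht]
    exact norm_nonneg g
  refine ⟨‖g‖, norm_nonneg g, lt_of_lt_of_le hg ?_⟩
  refine E.monotone i (le_sup_right : (0 : L1 E.ω) ≤ _ ⊔ 0) h0 (sup_le ?_ h0)
  rw [← Lp.coeFn_le]
  filter_upwards [Lp.coeFn_const 1 E.ω ‖g‖, ContinuousMap.coeFn_toLp (𝕜 := ℝ) (p := 1) E.ω g]
    with t h1 h2
  rw [h1, h2]
  exact (Real.le_norm_self _).trans (g.norm_coe_le_norm t)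

/-- A competitive equilibrium written in terms of the labels of a monotone labelling `f`: `v i l`
is the amount that agent `i` receives of every good with label `l`, and `q l` is the share of total
wealth that the commodity with label `l` represents. Labels with an empty fibre are allowed. -/
structure IsLabelledEquilibrium (E : Society n) (f : unitInterval →o Fin k)
    (v : Fin n → Fin k → ℝ) (q : Fin k → ℝ) : Prop where
  price_nonneg : ∀ l, 0 ≤ q l
  price_sum : ∑ l, q l = 1
  nonneg : ∀ i l, 0 ≤ v i l
  feasible : ∀ l, ∑ i, v i l ≤ 1
  budget : ∀ i, ∑ l, q l * v i l ≤ E.κ i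
  optimal : ∀ i, ∀ u : Fin k → ℝ, (∀ l, 0 ≤ u l) →
    E.U i (step E.ω f (v i)) < E.U i (step E.ω f u) → E.κ i < ∑ l, q l * u l

/-- Local nonsatiation below the whole endowment: moving towards a preferred constant bundle
strictly improves, by concavity. -/
lemma Society.lt_U_step_segment {f : unitInterval →o Fin k} {i : Fin n} {M : ℝ} (hM : 0 ≤ M)
    (hMlt : E.U i E.wholeEndowment < E.U i (Lp.const 1 E.ω M)) {v : Fin k → ℝ}
    (hv0 : ∀ l, 0 ≤ v l) (hv1 : ∀ l, v l ≤ 1) {t : ℝ} (ht0 : 0 < t) (ht1 : t ≤ 1) :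
    E.U i (step E.ω f v) < E.U i (step E.ω f fun l => (1 - t) * v l + t * M) := by
  have h1 : E.U i (step E.ω f v) ≤ E.U i E.wholeEndowment := by
    rw [Society.wholeEndowment, ← step_const f]
    exact E.monotone i (step_nonneg hv0) (step_nonneg fun _ => zero_le_one)
      (step_le_step fun _ => hv1 _)
  have h2 := (E.concave i).2 (step_nonneg (ω := E.ω) (f := f) hv0)
    (step_nonneg (ω := E.ω) (f := f) (v := fun _ => M) fun _ => hM) (sub_nonneg.2 ht1) ht0.le
    (sub_add_cancel 1 t)
  rw [← step_combination] at h2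
  simp only [smul_eq_mul] at h2
  rw [← step_const f M] at hMlt
  nlinarith

namespace IsLabelledEquilibrium

variable {f : unitInterval →o Fin k} {v : Fin n → Fin k → ℝ} {q : Fin k → ℝ}

lemma le_one (h : IsLabelledEquilibrium E f v q) (i : Fin n) (l : Fin k) : v i l ≤ 1 :=
  (Finset.single_le_sum (f := fun i => v i l) (fun j _ => h.nonneg j l)
    (Finset.mem_univ i)).trans (h.feasible l)

lemma price_le_one (h : IsLabelledEquilibrium E f v q) (l : Fin k) : q l ≤ 1 :=
  (Finset.single_le_sum (fun j _ => h.price_nonneg j) (Finset.mem_univ l)).trans_eq h.price_sum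

/-- In equilibrium no wealth sits in negligible commodities. By local nonsatiation every agent
must spend all of the claim on the other commodities, whose supply is then worth all wealth. -/
lemma price_eq_zero_of_null (h : IsLabelledEquilibrium E f v q) (hns : E.Nonsatiated) {l : Fin k}
    (hl : E.ω (f ⁻¹' {l}) = 0) : q l = 0 := by
  classical
  let s : Fin k → ℝ := fun l => if E.ω (f ⁻¹' {l}) = 0 then 0 else 1
  have hs0 : ∀ l, 0 ≤ s l := fun l => by
    by_cases h0 : E.ω (f ⁻¹' {l}) = 0 <;> simp [s, h0]
  have hκ : ∀ i, E.κ i ≤ ∑ l, q l * (s l * v i l) := fun i => by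
    obtain ⟨M, hM, hMlt⟩ := hns.exists_const i
    have hlt : ∀ t ∈ Ioc (0 : ℝ) 1,
        E.κ i < ∑ l, q l * (s l * ((1 - t) * v i l + t * M)) := by
      rintro t ⟨ht0, ht1⟩
      refine h.optimal i _ (fun l => mul_nonneg (hs0 l) (add_nonneg
        (mul_nonneg (sub_nonneg.2 ht1) (h.nonneg i l)) (mul_nonneg ht0.le hM))) ?_
      have hstep : step E.ω f (fun l => s l * ((1 - t) * v i l + t * M)) =
          step E.ω f fun l => (1 - t) * v i l + t * M :=
        step_congr_of_null fun l hl => by simp [s, hl]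
      rw [hstep]
      exact E.lt_U_step_segment hM hMlt (h.nonneg i) (h.le_one i) ht0 ht1
    have hcont : Continuous fun t : ℝ => ∑ l, q l * (s l * ((1 - t) * v i l + t * M)) := by
      fun_prop
    have hlim := (hcont.tendsto 0).mono_left (nhdsWithin_le_nhds (s := Ioi 0))
    simp only [sub_zero, one_mul, zero_mul, add_zero] at hlim
    refine ge_of_tendsto hlim ?_
    filter_upwards [Ioc_mem_nhdsGT zero_lt_one] with t ht using (hlt t ht).le
  have h1 : ∑ l, q l ≤ ∑ l, q l * s l :=
    calc ∑ l, q l = ∑ i, E.κ i := by rw [h.price_sum, E.κ_sum]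
      _ ≤ ∑ i, ∑ l, q l * (s l * v i l) := Finset.sum_le_sum fun i _ => hκ i
      _ = ∑ l, q l * s l * ∑ i, v i l := by
          rw [Finset.sum_comm]
          simp only [Finset.mul_sum, mul_assoc]
      _ ≤ ∑ l, q l * s l := Finset.sum_le_sum fun l _ =>
          mul_le_of_le_one_right (mul_nonneg (h.price_nonneg l) (hs0 l)) (h.feasible l)
  have h2 : ∀ l, q l * s l ≤ q l := fun l => by
    by_cases h0 : E.ω (f ⁻¹' {l}) = 0 <;> simp [s, h0, h.price_nonneg l]
  have h3 := (Finset.sum_eq_sum_iff_of_le fun l _ => h2 l).1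
    ((Finset.sum_le_sum fun l _ => h2 l).antisymm h1) l (Finset.mem_univ l)
  simpa [s, hl] using h3.symm

/-- The labelled equilibrium conditions are closed: only strictness in the optimality condition
could be lost in the limit, and it is recovered because every claim is positive and a preferred
bundle can be scaled down a little. -/
lemma of_tendsto {ι : Type*} {F : Filter ι} [F.NeBot] {f' : ι → unitInterval →o Fin k}
    {v' : ι → Fin n → Fin k → ℝ} {q' : ι → Fin k → ℝ}
    (h : ∀ᶠ c in F, IsLabelledEquilibrium E (f' c) (v' c) (q' c))
    (hf : Tendsto (fun c => E.ω {t | f' c t ≠ f t}) F (𝓝 0)) (hv : Tendsto v' F (𝓝 v))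
    (hq : Tendsto q' F (𝓝 q)) : IsLabelledEquilibrium E f v q := by
  have hv' : ∀ i l, Tendsto (fun c => v' c i l) F (𝓝 (v i l)) := fun i l =>
    tendsto_pi_nhds.1 (tendsto_pi_nhds.1 hv i) l
  have hq' : ∀ l, Tendsto (fun c => q' c l) F (𝓝 (q l)) := tendsto_pi_nhds.1 hq
  have hv0 : ∀ i l, 0 ≤ v i l := fun i l =>
    ge_of_tendsto (hv' i l) (h.mono fun c hc => hc.nonneg i l)
  -- what survives of optimality in the limit
  have hweak : ∀ i, ∀ u : Fin k → ℝ, (∀ l, 0 ≤ u l) →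
      E.U i (step E.ω f (v i)) < E.U i (step E.ω f u) → E.κ i ≤ ∑ l, q l * u l := by
    intro i u hu hlt
    have hU : ∀ {w : ι → Fin k → ℝ} {w₀ : Fin k → ℝ}, Tendsto w F (𝓝 w₀) → (∀ l, 0 ≤ w₀ l) →
        (∀ᶠ c in F, ∀ l, 0 ≤ w c l) →
        Tendsto (fun c => E.U i (step E.ω (f' c) (w c))) F (𝓝 (E.U i (step E.ω f w₀))) := by
      intro w w₀ hw hw₀ hwn
      refine (E.continuous i (step E.ω f w₀) (step_nonneg hw₀)).tendsto.comp
        (tendsto_nhdsWithin_iff.2 ⟨tendsto_step hf hw, hwn.mono fun c hc => step_nonneg hc⟩)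
    have h1 := hU (tendsto_pi_nhds.1 hv i) (hv0 i) (h.mono fun c hc => hc.nonneg i)
    have h2 := hU (tendsto_const_nhds (x := u)) hu (Eventually.of_forall fun _ => hu)
    refine ge_of_tendsto (tendsto_finsetSum _ fun l _ => (hq' l).mul_const (u l)) ?_
    filter_upwards [h, h1.eventually_lt h2 hlt] with c hc hclt using (hc.optimal i u hu hclt).le
  refine ⟨fun l => ge_of_tendsto (hq' l) (h.mono fun c hc => hc.price_nonneg l), ?_, hv0,
    fun l => ?_, fun i => ?_, fun i u hu hlt => ?_⟩
  · refine tendsto_nhds_unique (tendsto_finsetSum _ fun l _ => hq' l)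
      (tendsto_const_nhds.congr' (h.mono fun c hc => hc.price_sum.symm))
  · exact le_of_tendsto (tendsto_finsetSum _ fun i _ => hv' i l) (h.mono fun c hc => hc.feasible l)
  · exact le_of_tendsto (tendsto_finsetSum _ fun l _ => (hq' l).mul (hv' i l))
      (h.mono fun c hc => hc.budget i)
  · have hscale : Tendsto (fun r : ℝ => E.U i (r • step E.ω f u)) (𝓝[<] 1)
        (𝓝 (E.U i (step E.ω f u))) := by
      have hr : Tendsto (fun r : ℝ => r • step E.ω f u) (𝓝[<] 1) (𝓝 (step E.ω f u)) := by
        have : Continuous fun r : ℝ => r • step E.ω f u := by fun_prop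
        simpa using (this.tendsto 1).mono_left (nhdsWithin_le_nhds (s := Iio 1))
      refine (E.continuous i (step E.ω f u) (step_nonneg hu)).tendsto.comp
        (tendsto_nhdsWithin_iff.2 ⟨hr, ?_⟩)
      filter_upwards [Ioo_mem_nhdsLT (zero_lt_one' ℝ)] with r hr
      have : r • step E.ω f u = step E.ω f fun l => r * u l + 0 * u l := by
        rw [step_combination, zero_smul, add_zero]
      change 0 ≤ r • step E.ω f u
      rw [this]
      exact step_nonneg fun l => by simpa using mul_nonneg hr.1.le (hu l)
    obtain ⟨r, hrlt, hr0, hr1⟩ :=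
      ((hscale.eventually_const_lt hlt).and (Ioo_mem_nhdsLT (zero_lt_one' ℝ))).exists
    have heq : r • step E.ω f u = step E.ω f fun l => r * u l := by
      simpa using (step_combination (ω := E.ω) f r 0 u u).symm
    rw [heq] at hrlt
    have h1 := hweak i _ (fun l => mul_nonneg hr0.le (hu l)) hrlt
    have h2 : ∑ l, q l * (r * u l) = r * ∑ l, q l * u l := by
      rw [Finset.mul_sum]
      exact Finset.sum_congr rfl fun l _ => by ring
    have h3 := E.κ_pos i
    rw [h2] at h1
    nlinarith

end IsLabelledEquilibrium

namespace Labelling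

variable {π : Classification E.ω}

/-- A competitive allocation under `π` gives an equilibrium in terms of labels; nonsatiation rules
out that all prices vanish. -/
lemma exists_isLabelledEquilibrium (L : Labelling π k) (hns : E.Nonsatiated)
    {x : Fin n → π.Commodity → ℝ} (hx : x ∈ W E π) :
    ∃ v q, IsLabelledEquilibrium E L.f v q ∧ ∀ i, π.toBundle (x i) = step E.ω L.f (v i) := by
  obtain ⟨p, hp⟩ := hx
  have hω := π.measureReal_pos
  let v : Fin n → Fin k → ℝ := fun i => Function.extend L.idx (fun C => x i C / E.ω.real C.1) 0
  have hv : ∀ i C, v i (L.idx C) = x i C / E.ω.real C.1 := fun i C =>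
    L.idx_injective.extend_apply _ _ C
  have hv' : ∀ i, ∀ l ∉ range L.idx, v i l = 0 := fun i l hl => Function.extend_apply' _ _ l hl
  have hbundle : ∀ i, π.toBundle (x i) = step E.ω L.f (v i) := fun i =>
    L.toBundle_eq_step fun C => (hv i C).symm
  have hv0 : ∀ i l, 0 ≤ v i l := fun i l => by
    by_cases hl : l ∈ range L.idx
    · obtain ⟨C, rfl⟩ := hl
      rw [hv]
      exact div_nonneg (hp.nonneg i C) (hω C).le
    · rw [hv' i l hl]
  have hfeas : ∀ l, ∑ i, v i l ≤ 1 := fun l => by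
    by_cases hl : l ∈ range L.idx
    · obtain ⟨C, rfl⟩ := hl
      simp only [hv]
      rw [← Finset.sum_div, div_le_one (hω C)]
      exact hp.feasible C
    · rw [Finset.sum_eq_zero fun i _ => hv' i l hl]
      exact zero_le_one
  have hopt : ∀ i, ∀ u : Fin k → ℝ, (∀ l, 0 ≤ u l) →
      E.U i (step E.ω L.f (v i)) < E.U i (step E.ω L.f u) →
      E.κ i * ∑ C, p C * E.ω.real C.1 < ∑ C, p C * (E.ω.real C.1 * u (L.idx C)) := by
    intro i u hu hlt
    refine hp.optimal i (fun C => E.ω.real C.1 * u (L.idx C))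
      (fun C => mul_nonneg (hω C).le (hu _)) ?_
    rw [Society.V, Society.V, hbundle, L.toBundle_eq_step (v := u)
      fun C => mul_div_cancel_left₀ _ (hω C).ne']
    exact hlt
  have hn : Nonempty (Fin n) := by
    by_contra h
    rw [not_nonempty_iff] at h
    simpa using E.κ_sum
  have hwealth : 0 < ∑ C, p C * E.ω.real C.1 := by
    refine (Finset.sum_nonneg fun C _ =>
      mul_nonneg (hp.price_nonneg C) (hω C).le).lt_of_ne' fun h0 => ?_
    obtain ⟨i⟩ := hn
    obtain ⟨M, hM, hMlt⟩ := hns.exists_const i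
    have hlt := hopt i (fun _ => M) (fun _ => hM) (by
      simpa using E.lt_U_step_segment (f := L.f) hM hMlt (hv0 i)
        (fun l => (Finset.single_le_sum (f := fun i => v i l) (fun j _ => hv0 j l)
          (Finset.mem_univ i)).trans (hfeas l)) zero_lt_one le_rfl)
    simp only [← mul_assoc, ← Finset.sum_mul, h0] at hlt
    simp at hlt
  set w := ∑ C, p C * E.ω.real C.1 with hw
  let q : Fin k → ℝ := Function.extend L.idx (fun C => p C * E.ω.real C.1 / w) 0
  have hq : ∀ C, q (L.idx C) = p C * E.ω.real C.1 / w := fun C =>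
    L.idx_injective.extend_apply _ _ C
  have hq' : ∀ l ∉ range L.idx, q l = 0 := fun l hl => Function.extend_apply' _ _ l hl
  have hcost : ∀ u : Fin k → ℝ,
      ∑ l, q l * u l = (∑ C, p C * (E.ω.real C.1 * u (L.idx C))) / w := fun u => by
    rw [← L.sum_idx (F := fun l => q l * u l) fun l hl => by rw [hq' l hl, zero_mul],
      Finset.sum_div]
    exact Finset.sum_congr rfl fun C _ => by rw [hq]; ring
  refine ⟨v, q, ⟨fun l => ?_, ?_, hv0, hfeas, fun i => ?_, fun i u hu hlt => ?_⟩, hbundle⟩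
  · by_cases hl : l ∈ range L.idx
    · obtain ⟨C, rfl⟩ := hl
      rw [hq]
      exact div_nonneg (mul_nonneg (hp.price_nonneg C) (hω C).le) hwealth.le
    · rw [hq' l hl]
  · have := hcost fun _ => 1
    simp only [mul_one, ← hw, div_self hwealth.ne'] at this
    exact this
  · rw [hcost, div_le_iff₀ hwealth]
    refine le_of_eq_of_le (Finset.sum_congr rfl fun C _ => ?_) (hp.budget i)
    rw [hv, mul_div_cancel₀ _ (hω C).ne']
  · rw [hcost, lt_div_iff₀ hwealth]
    exact hopt i u hu hlt

/-- Conversely, an equilibrium in terms of labels is a competitive allocation. -/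
lemma mem_W (L : Labelling π k) {v : Fin n → Fin k → ℝ} {q : Fin k → ℝ}
    (h : IsLabelledEquilibrium E L.f v q) (hns : E.Nonsatiated) :
    (fun i C => v i (L.idx C) * E.ω.real C.1) ∈ W E π := by
  have hω := π.measureReal_pos
  have hcost : ∀ u : Fin k → ℝ, ∑ C, q (L.idx C) / E.ω.real C.1 * (u (L.idx C) * E.ω.real C.1) =
      ∑ l, q l * u l := fun u => by
    rw [← L.sum_idx (F := fun l => q l * u l) fun l hl => by
      rw [h.price_eq_zero_of_null hns (by rw [L.fiber_eq_empty hl, measure_empty]), zero_mul]]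
    refine Finset.sum_congr rfl fun C _ => ?_
    have := (hω C).ne'
    field_simp
  have hwealth : ∑ C, q (L.idx C) / E.ω.real C.1 * E.ω.real C.1 = 1 := by
    simpa [h.price_sum] using hcost fun _ => 1
  refine ⟨fun C => q (L.idx C) / E.ω.real C.1, fun C => div_nonneg (h.price_nonneg _) (hω C).le,
    fun i C => mul_nonneg (h.nonneg _ _) (hω C).le, fun C => ?_, fun i => ?_, fun i y hy hlt => ?_⟩
  · rw [← Finset.sum_mul]
    exact mul_le_of_le_one_left (hω C).le (h.feasible _)
  · rw [hwealth, mul_one, hcost]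
    exact h.budget i
  · let u : Fin k → ℝ := Function.extend L.idx (fun C => y C / E.ω.real C.1) 0
    have hu : ∀ C, u (L.idx C) = y C / E.ω.real C.1 := fun C =>
      L.idx_injective.extend_apply _ _ C
    have hu0 : ∀ l, 0 ≤ u l := fun l => by
      by_cases hl : l ∈ range L.idx
      · obtain ⟨C, rfl⟩ := hl
        rw [hu]
        exact div_nonneg (hy C) (hω C).le
      · exact (show u l = 0 from Function.extend_apply' _ _ l hl).ge
    rw [Society.V, Society.V, L.toBundle_eq_step fun C => (hu C).symm,
      L.toBundle_eq_step fun C => mul_div_cancel_right₀ _ (hω C).ne'] at hlt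
    have h1 := h.optimal i u hu0 hlt
    rw [← hcost] at h1
    rw [hwealth, mul_one]
    refine h1.trans_eq (Finset.sum_congr rfl fun C _ => ?_)
    rw [hu, div_mul_cancel₀ _ (hω C).ne']

/-- The configuration in which an equilibrium in terms of labels results. -/
def toConfiguration (L : Labelling π k) {v : Fin n → Fin k → ℝ} {q : Fin k → ℝ}
    (h : IsLabelledEquilibrium E L.f v q) : Configuration E where
  π := π
  x i C := v i (L.idx C) * E.ω.real C.1
  nonneg _ _ := mul_nonneg (h.nonneg _ _) measureReal_nonneg

lemma toConfiguration_mem (L : Labelling π k) {v : Fin n → Fin k → ℝ} {q : Fin k → ℝ}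
    (h : IsLabelledEquilibrium E L.f v q) (hns : E.Nonsatiated) :
    L.toConfiguration h ∈ graphW E k :=
  ⟨L.card_le, L.mem_W h hns⟩

lemma toBundle_toConfiguration (L : Labelling π k) {v : Fin n → Fin k → ℝ} {q : Fin k → ℝ}
    (h : IsLabelledEquilibrium E L.f v q) (i : Fin n) :
    π.toBundle ((L.toConfiguration h).x i) = step E.ω L.f (v i) :=
  L.toBundle_eq_step fun C => mul_div_cancel_right₀ _ (π.measureReal_pos C).ne'

end Labelling

end Equilibrium

/-! ### The set of competitive configurations -/

section Graph

variable {n k : ℕ} {E : Society n}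

/-- With a single commodity, giving every agent the claimed share of it is competitive. -/
lemma graphW_nonempty (hns : E.Nonsatiated) (hk : 1 ≤ k) : (graphW E k).Nonempty := by
  let o : Fin k := ⟨0, hk⟩
  let f : unitInterval →o Fin k := ⟨fun _ => o, monotone_const⟩
  have hf : ∀ t, E.ω (f ⁻¹' {f t}) ≠ 0 := fun t => by
    have : f ⁻¹' {f t} = univ := eq_univ_of_forall fun s => rfl
    rw [this, measure_univ]
    exact one_ne_zero
  obtain ⟨π, L, hL⟩ := Classification.exists_of_charged f hf
  have hκ0 : ∀ i, 0 ≤ E.κ i := fun i => (E.κ_pos i).le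
  have h : IsLabelledEquilibrium E L.f (fun i _ => E.κ i) (Pi.single o 1) := by
    refine ⟨fun l => (Pi.single_nonneg.2 zero_le_one : (0 : Fin k → ℝ) ≤ Pi.single o 1) l,
      by simp, fun i _ => hκ0 i,
      fun _ => E.κ_sum.le, fun i => by simp [← Finset.sum_mul], fun i u hu hlt => ?_⟩
    have : ∑ l, (Pi.single o 1 : Fin k → ℝ) l * u l = u o := by
      simp [Pi.single_apply]
    rw [this]
    by_contra hle
    refine hlt.not_ge (E.monotone i (step_nonneg hu) (step_nonneg fun _ => hκ0 i)
      (step_le_step fun t => ?_))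
    rw [hL]
    exact not_lt.1 hle
  exact ⟨_, L.toConfiguration_mem h hns⟩

/-- Along an ultrafilter of competitive configurations the labellings, the amounts per label and
the wealth shares all converge; the limit labelling, once its negligible fibres are collapsed,
carries a competitive configuration, which is the limit. -/
lemma isCompact_graphW (hns : E.Nonsatiated) (hk : 1 ≤ k) : IsCompact (graphW E k) := by
  rw [isCompact_iff_ultrafilter_le_nhds']
  intro F hF
  have hdata : ∀ c : Configuration E, ∃ (f : unitInterval →o Fin k) (v : Fin n → Fin k → ℝ)
      (q : Fin k → ℝ), c ∈ graphW E k → ∃ L : Labelling c.π k, L.f = f ∧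
        IsLabelledEquilibrium E f v q ∧ ∀ i, c.π.toBundle (c.x i) = step E.ω f (v i) := by
    intro c
    by_cases hc : c ∈ graphW E k
    · obtain ⟨L⟩ := c.π.exists_labelling hc.1
      obtain ⟨v, q, h, hb⟩ := L.exists_isLabelledEquilibrium hns hc.2
      exact ⟨L.f, v, q, fun _ => ⟨L, rfl, h, hb⟩⟩
    · exact ⟨⟨fun _ => ⟨0, hk⟩, monotone_const⟩, 0, 0, fun h => absurd h hc⟩
  choose f v q hfvq using hdata
  have heq : ∀ᶠ c in (F : Filter (Configuration E)),
      IsLabelledEquilibrium E (f c) (v c) (q c) := by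
    filter_upwards [hF] with c hc
    obtain ⟨L, -, h, -⟩ := hfvq c hc
    exact h
  -- pointwise limit of the labellings
  have hlim : ∀ t, ∃ l : Fin k, ∀ᶠ c in (F : Filter (Configuration E)), f c t = l := by
    intro t
    obtain ⟨l, -, hl⟩ := isCompact_univ.ultrafilter_le_nhds' (F.map fun c => f c t) univ_mem
    rw [nhds_discrete] at hl
    have hmem : {l} ∈ F.map fun c => f c t := hl (mem_pure.2 (mem_singleton l))
    exact ⟨l, hmem⟩
  choose g₀ hg₀ using hlim
  let g₁ : unitInterval →o Fin k := ⟨g₀, fun s t hst => by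
    obtain ⟨c, hs, ht⟩ := ((hg₀ s).and (hg₀ t)).exists
    rw [← hs, ← ht]
    exact (f c).monotone hst⟩
  obtain ⟨g, hgg₁, hg⟩ := exists_labelling_charged (ω := E.ω) g₁
  have hf : Tendsto (fun c => E.ω {t | f c t ≠ g t}) F (𝓝 0) := by
    refine tendsto_of_tendsto_of_tendsto_of_le_of_le tendsto_const_nhds
      (tendsto_measure_ne (ω := E.ω) f g₁ hg₀) (fun _ => zero_le) fun c => ?_
    calc E.ω {t | f c t ≠ g t} ≤ E.ω ({t | f c t ≠ g₁ t} ∪ {t | g₁ t ≠ g t}) := by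
          refine measure_mono fun t ht => ?_
          by_contra h
          simp only [mem_union, mem_ofPred_eq, not_or, not_not] at h
          exact ht (h.1.trans h.2)
      _ ≤ E.ω {t | f c t ≠ g₁ t} := (measure_union_le _ _).trans_eq (by rw [hgg₁, add_zero])
  obtain ⟨v', -, hv⟩ := (isCompact_Icc (a := (0 : Fin n → Fin k → ℝ)) (b := 1)).ultrafilter_le_nhds'
    (F.map v) (Ultrafilter.mem_map.2 (by
      filter_upwards [heq] with c hc
      exact ⟨fun i l => hc.nonneg i l, fun i l => hc.le_one i l⟩))
  obtain ⟨q', -, hq⟩ := (isCompact_Icc (a := (0 : Fin k → ℝ)) (b := 1)).ultrafilter_le_nhds'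
    (F.map q) (Ultrafilter.mem_map.2 (by
      filter_upwards [heq] with c hc
      exact ⟨fun l => hc.price_nonneg l, fun l => hc.price_le_one l⟩))
  have hv : Tendsto v F (𝓝 v') := hv
  have hq : Tendsto q F (𝓝 q') := hq
  obtain ⟨π, L, rfl⟩ := Classification.exists_of_charged g hg
  have h := IsLabelledEquilibrium.of_tendsto heq hf hv hq
  refine ⟨L.toConfiguration h, L.toConfiguration_mem h hns, ?_⟩
  rw [nhds_induced, ← map_le_iff_le_comap, nhds_prod_eq]
  refine Tendsto.prodMk (tendsto_iff_edist_tendsto_0.2 ?_) (tendsto_pi_nhds.2 fun i => ?_)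
  · refine tendsto_of_tendsto_of_tendsto_of_le_of_le' tendsto_const_nhds hf
      (Eventually.of_forall fun _ => zero_le) ?_
    filter_upwards [hF] with c hc
    obtain ⟨L', hL', -⟩ := hfvq c hc
    rw [← hL']
    exact L'.edist_le L
  · have := tendsto_step hf (tendsto_pi_nhds.1 hv i)
    rw [← L.toBundle_toConfiguration h i] at this
    refine this.congr' ?_
    filter_upwards [hF] with c hc
    obtain ⟨-, -, -, hb⟩ := hfvq c hc
    exact (hb i).symm

lemma Configuration.toBundle_nonneg (c : Configuration E) (i : Fin n) :
    0 ≤ c.π.toBundle (c.x i) := by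
  obtain ⟨L⟩ := c.π.exists_labelling le_rfl
  let v : Fin c.π.card → ℝ := Function.extend L.idx (fun C => c.x i C / E.ω.real C.1) 0
  have hv : ∀ C, v (L.idx C) = c.x i C / E.ω.real C.1 := fun C =>
    L.idx_injective.extend_apply _ _ C
  rw [L.toBundle_eq_step fun C => (hv C).symm]
  refine step_nonneg fun l => ?_
  by_cases hl : l ∈ range L.idx
  · obtain ⟨C, rfl⟩ := hl
    rw [hv]
    exact div_nonneg (c.nonneg i C) measureReal_nonneg
  · exact (show v l = 0 from Function.extend_apply' _ _ l hl).ge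

lemma Configuration.continuous_welfare :
    Continuous (Configuration.welfare : Configuration E → ℝ) := by
  refine continuous_finsetSum _ fun i _ => ?_
  have hind : Continuous fun c : Configuration E => (c.π, fun i => c.π.toBundle (c.x i)) :=
    continuous_induced_dom
  have h : Continuous fun c : Configuration E => c.π.toBundle (c.x i) :=
    (continuous_apply i).comp (continuous_snd.comp hind)
  exact (E.continuous i).comp_continuous h fun c => c.toBundle_nonneg i

lemma Configuration.isParetoOptimal_of_isMaxOn {G : Set (Configuration E)} {c : Configuration E}
    (hc : c ∈ G) (hmax : IsMaxOn Configuration.welfare G c) :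
    Configuration.IsParetoOptimal G c :=
  ⟨hc, fun ⟨_, hd, hle, i, hlt⟩ => (hmax hd).not_gt
    (Finset.sum_lt_sum (fun j _ => hle j) ⟨i, Finset.mem_univ i, hlt⟩)⟩

end Graph

end Conflation

theorem theorem2 {n : ℕ} (E : Conflation.Society n) (k : ℕ) (hk : 1 ≤ k)
    (hns : ∀ i, ∃ b : Conflation.L1 E.ω, 0 ≤ b ∧ E.U i E.wholeEndowment < E.U i b) :
    (∃ c, Conflation.Configuration.IsParetoOptimal (Conflation.graphW E k) c) ∧
    (Conflation.graphW E k).Nonempty ∧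
    IsCompact (Conflation.graphW E k) ∧
    (∃ c ∈ Conflation.graphW E k,
      IsMaxOn Conflation.Configuration.welfare (Conflation.graphW E k) c) ∧
    (∀ c ∈ Conflation.graphW E k,
      IsMaxOn Conflation.Configuration.welfare (Conflation.graphW E k) c →
        Conflation.Configuration.IsParetoOptimal (Conflation.graphW E k) c) := by
  have hne := Conflation.graphW_nonempty hns hk
  have hcomp := Conflation.isCompact_graphW hns hk
  obtain ⟨c, hc, hmax⟩ :=
    hcomp.exists_isMaxOn hne Conflation.Configuration.continuous_welfare.continuousOn
  exact ⟨⟨c, Conflation.Configuration.isParetoOptimal_of_isMaxOn hc hmax⟩, hne, hcomp,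
    ⟨c, hc, hmax⟩, fun _ hc hmax => Conflation.Configuration.isParetoOptimal_of_isMaxOn hc hmax⟩
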